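/- For $n\ge 1$, an $\alpha/\beta$-staircase tableau of size $n$ is a filling of the Young diagram of shape $(n,n-1,\dots,1)$ in which each box $(i,j)$ (row $i$, column $j$, $i+j\le n+1$) is empty or contains a symbol $\alpha$ or $\beta$, such that all boxes above an $\alpha$ in its column are empty, all boxes to the left of a $\beta$ in its row are empty, and every box $(i,j)$ of the main diagonal $i+j=n+1$ is non-empty. Let $N_\alpha(S)$, $N_\beta(S)$ be the numbers of symbols $\alpha$, $\beta$ in $S$. For weights $\alpha,\beta\in(0,\infty)$ let $\mathbb P_{n,\alpha,\beta}$ be the probability measure on the (finite) set $\overline{\mathcal S}_n$ of these tableaux with $$\mathbb P_{n,\alpha,\beta}(S)=\frac{\alpha^{N_\alpha(S)}\beta^{N_\beta(S)}}{\sum_{T\in\overline{\mathcal S}_n}\alpha^{N_\alpha(T)}\beta^{N_\beta(T)}}.$$ If exactly one of the weights is $\infty$, $\mathbb P_{n,\alpha,\beta}$ denotes a limit of such measures as that weight tends to $\infty$ along a sequence with the other weight fixed; if $\alpha=\beta=\infty$, it denotes any measure on $\overline{\mathcal S}_n$ that is a limit of $\mathbb P_{n,\alpha_k,\beta_k}$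 along some sequences $\alpha_k\to\infty$, $\beta_k\to\infty$ (for instance $\alpha_k=\beta_k$). **Theorem.** Fix weights $\alpha,\beta\in(0,\infty]$. Then measures $\mathbb P_{n,\alpha,\beta}$ as above exist for every $n$. Moreover, for any choice of them (one for each $n\ge1$), if $X_n$ is the number of non-empty boxes on the second main diagonal $\{(n-j,j):1\le j\le n-1\}$ of a random tableau with law $\mathbb P_{n,\alpha,\beta}$, then $$X_n\xrightarrow{\;d\;}\operatorname{Pois}(1)\qquad\text{as } n\to\infty .$$ -/

import Mathlib

open MeasureTheory ProbabilityTheory Filter Topology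
open scoped NNReal ENNReal

/-- The two symbols that a box of an α/β-staircase tableau may contain. -/
inductive BoxSymbol where
  | alpha : BoxSymbol
  | beta : BoxSymbol
  deriving DecidableEq

instance : Fintype BoxSymbol :=
  ⟨{BoxSymbol.alpha, BoxSymbol.beta}, fun x => by cases x <;> simp⟩

/-- An α/β-staircase tableau of size `n`, of shape `(n, n - 1, …, 1)`. Rows and columns are indexed
from `0` here, starting in the north-west corner, so `(i, j)` is the box in row `i + 1` and column
`j + 1`; it lies in the shape iff `i + j < n`, and on the main diagonal iff `i + j + 1 = n`.
An empty box is `none`; positions outside the shape carry no symbol. -/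
@[ext]
structure ABTableau (n : ℕ) where
  entry : Fin n → Fin n → Option BoxSymbol
  outside : ∀ i j : Fin n, n ≤ (i : ℕ) + j → entry i j = none
  above_alpha : ∀ i j : Fin n, entry i j = some BoxSymbol.alpha →
    ∀ i' : Fin n, i' < i → entry i' j = none
  left_beta : ∀ i j : Fin n, entry i j = some BoxSymbol.beta →
    ∀ j' : Fin n, j' < j → entry i j' = none
  diagonal : ∀ i j : Fin n, (i : ℕ) + j + 1 = n → entry i j ≠ none

namespace ABTableau

theorem entry_injective (n : ℕ) : Function.Injective (entry : ABTableau n → _) :=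
  fun _ _ h => ABTableau.ext h

noncomputable instance (n : ℕ) : Fintype (ABTableau n) :=
  Fintype.ofInjective _ (entry_injective n)

/-- Every set of tableaux is an event. -/
instance (n : ℕ) : MeasurableSpace (ABTableau n) := ⊤

variable {n : ℕ}

/-- The number of boxes of `S` that contain the symbol `y`. -/
def count (S : ABTableau n) (y : BoxSymbol) : ℕ :=
  (Finset.univ.filter fun p : Fin n × Fin n => S.entry p.1 p.2 = some y).card

/-- The weight `α ^ N_α * β ^ N_β` of a tableau. -/
noncomputable def weight (S : ABTableau n) (α β : ℝ≥0) : ℝ≥0 :=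
  α ^ S.count BoxSymbol.alpha * β ^ S.count BoxSymbol.beta

/-- The number of non-empty boxes on the second main diagonal, that is, among the boxes
`(n - j, j)`, `1 ≤ j ≤ n - 1`, in one-based numbering. -/
def secondDiagonalCount (S : ABTableau n) : ℕ :=
  (Finset.univ.filter fun p : Fin n × Fin n =>
    (p.1 : ℕ) + p.2 + 2 = n ∧ S.entry p.1 p.2 ≠ none).card

/-- The generating function `Z_n(α, β)`: the total weight of all tableaux of size `n`. -/
noncomputable def partitionFunction (n : ℕ) (α β : ℝ≥0) : ℝ≥0 :=
  ∑ S : ABTableau n, S.weight α β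

/-- The probability of the tableau `S` for finite weights `α`, `β`. -/
noncomputable def prob (α β : ℝ≥0) (S : ABTableau n) : ℝ≥0 :=
  S.weight α β / partitionFunction n α β

/-- `P` is a law of the random weighted tableau of size `n` with weights `α, β ∈ (0, ∞]`: it is a
limit of the laws with finite positive weights `u k`, `v k`, where a finite weight is kept fixed and
an infinite one is approached. If both weights are finite this says that `P {S} = prob α β S`.
If both are infinite, the limit depends on how the two weights grow relative to each other, and
every possible limit is admitted (e.g. the limit along `u k = v k`). -/
def IsWeightedLaw (α β : ℝ≥0∞) (P : ProbabilityMeasure (ABTableau n)) : Prop :=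
  ∃ u v : ℕ → ℝ≥0,
    (∀ k, 0 < u k) ∧ (∀ k, 0 < v k) ∧
    (α ≠ ∞ → ∀ k, (u k : ℝ≥0∞) = α) ∧ (β ≠ ∞ → ∀ k, (v k : ℝ≥0∞) = β) ∧
    Tendsto (fun k => (u k : ℝ≥0∞)) atTop (𝓝 α) ∧
    Tendsto (fun k => (v k : ℝ≥0∞)) atTop (𝓝 β) ∧
    ∀ S : ABTableau n, Tendsto (fun k => prob (u k) (v k) S) atTop (𝓝 (P {S}))

end ABTableau

/-! Let `z` mark non-empty boxes of the second diagonal and `x` the rows without `β`. Attaching a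
column on the left is governed only by which rows are free of `β`, and summing over the columns
replaces `x` by `x + b`. The only correction comes from the one new second-diagonal box. This gives
the two-step recursion `genFun_add_two`, solved in closed form by `genFun_eq_sum`.

At `x = 1` the factors are `a + b + i * a * b = a * b * (a⁻¹ + b⁻¹ + i)`. Dividing by the total
weight, the coefficient of `(z - 1) ^ r` becomes `binomialMoment (n - r) r s`, where the weights
enter only through `s = a⁻¹ + b⁻¹` (`sum_prob_mul_pow`). It is continuous on `s ≥ 0`, so infinite
weights are covered with reciprocal `0`, and every admissible limit law has the same generating
function (`IsWeightedLaw.sum_mul_pow`).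

As `n → ∞` the coefficients tend to `1 / r!` and are bounded by `1 / r!`, so the generating function
tends to `exp (z - 1)` (`tendsto_sum_binomialMoment`). At `z = exp (i t)` this is convergence of
characteristic functions to that of `Pois(1)`. -/

namespace ABTableau

/-! ### Weighted sums over a single column -/

section GeneratingFunction

variable {R : Type*} [CommRing R]

theorem sum_option_boxSymbol (f : Option BoxSymbol → R) :
    ∑ d, f d = f none + (f (some .alpha) + f (some .beta)) := by
  rw [Fintype.sum_option]
  congr 1
  rw [show (Finset.univ : Finset BoxSymbol) = {.alpha, .beta} from rfl,
    Finset.sum_pair (by simp)]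

/-- The weight of a single box content. -/
def symbolWeight (a b : R) : Option BoxSymbol → R
  | none => 1
  | some .alpha => a
  | some .beta => b

/-- A column `c` may be attached to the left of rows, those satisfying `A` being free of `β`. -/
def ColumnValid {m : ℕ} (A : Fin m → Prop) (c : Fin m → Option BoxSymbol) : Prop :=
  (∀ i, c i ≠ none → A i) ∧ ∀ i, c i = some .alpha → ∀ i' < i, c i' = none

open Classical in
/-- The weight of a box of a new column: `x` marks rows without `β`, `ζ` marks a non-empty box. -/
noncomputable def columnWeight (a b x : R) (A : Prop) (ζ : R) : Option BoxSymbol → R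
  | none => if A then x else 1
  | some .alpha => ζ * a * x
  | some .beta => ζ * b

open Classical in
/-- The product of `x` over the rows satisfying `A`. -/
noncomputable def rowProd {m : ℕ} (A : Fin m → Prop) (x : R) : R :=
  ∏ i, if A i then x else 1

open Classical in
/-- The total weight of the columns that can be attached to the left of given rows. -/
noncomputable def columnSum {m : ℕ} (a b x : R) (A : Fin m → Prop) (ζ : Fin m → R) : R :=
  ∑ c : Fin m → Option BoxSymbol,
    if ColumnValid A c then ∏ i, columnWeight a b x (A i) (ζ i) (c i) else 0

theorem columnValid_snoc_none {m : ℕ} (A : Fin (m + 1) → Prop) (c : Fin m → Option BoxSymbol) :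
    ColumnValid A (Fin.snoc c none : Fin (m + 1) → Option BoxSymbol) ↔
      ColumnValid (fun i => A i.castSucc) c := by
  simp [ColumnValid, Fin.forall_fin_succ']

theorem columnValid_snoc_alpha {m : ℕ} (A : Fin (m + 1) → Prop) (c : Fin m → Option BoxSymbol) :
    ColumnValid A (Fin.snoc c (some .alpha) : Fin (m + 1) → Option BoxSymbol) ↔
      A (Fin.last m) ∧ c = fun _ => none := by
  simp only [ColumnValid, Fin.forall_fin_succ', Fin.snoc_castSucc, Fin.snoc_last, funext_iff]
  constructor
  · rintro ⟨⟨-, h⟩, -, h'⟩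
    exact ⟨h (by simp), fun i => (h' trivial).1 i (Fin.castSucc_lt_last i)⟩
  · rintro ⟨h, h'⟩
    simp [h, h']

theorem columnValid_snoc_beta {m : ℕ} (A : Fin (m + 1) → Prop) (c : Fin m → Option BoxSymbol) :
    ColumnValid A (Fin.snoc c (some .beta) : Fin (m + 1) → Option BoxSymbol) ↔
      A (Fin.last m) ∧ ColumnValid (fun i => A i.castSucc) c := by
  simp [ColumnValid, Fin.forall_fin_succ', Fin.le_last]
  tauto

theorem rowProd_succ {m : ℕ} (A : Fin (m + 1) → Prop) [Decidable (A (Fin.last m))] (x : R) :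
    rowProd A x = rowProd (fun i : Fin m => A i.castSucc) x *
      (if A (Fin.last m) then x else 1) := by
  classical
  simp only [rowProd, Fin.prod_univ_castSucc]
  congr

theorem columnSum_succ_of_not {m : ℕ} (a b x : R) {A : Fin (m + 1) → Prop}
    (ζ : Fin (m + 1) → R) (h : ¬ A (Fin.last m)) :
    columnSum a b x A ζ =
      columnSum a b x (fun i => A i.castSucc) (fun i => ζ i.castSucc) := by
  classical
  simp only [columnSum]
  rw [← (Fin.snocEquiv fun _ => Option BoxSymbol).sum_comp, Fintype.sum_prod_type,
    sum_option_boxSymbol]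
  simp [Fin.snocEquiv, columnValid_snoc_none, columnValid_snoc_alpha, columnValid_snoc_beta, h,
    Fin.prod_univ_castSucc, columnWeight]

/-- Condition on the bottom box: empty or `β` leaves the boxes above unconstrained, while `α` forces
them all to be empty. -/
theorem columnSum_succ_of_pos {m : ℕ} (a b x : R) {A : Fin (m + 1) → Prop}
    (ζ : Fin (m + 1) → R) (h : A (Fin.last m)) :
    columnSum a b x A ζ =
      (x + ζ (Fin.last m) * b) *
        columnSum a b x (fun i => A i.castSucc) (fun i => ζ i.castSucc) +
      ζ (Fin.last m) * a * x * rowProd (fun i : Fin m => A i.castSucc) x := by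
  classical
  simp only [columnSum]
  rw [← (Fin.snocEquiv fun _ => Option BoxSymbol).sum_comp, Fintype.sum_prod_type,
    sum_option_boxSymbol]
  simp only [Fin.snocEquiv, Equiv.coe_fn_mk, columnValid_snoc_none, columnValid_snoc_alpha,
    columnValid_snoc_beta, h, true_and, Fin.prod_univ_castSucc, Fin.snoc_castSucc, Fin.snoc_last,
    Finset.sum_ite_eq', Finset.mem_univ, if_true]
  simp only [columnWeight, if_true, ← ite_zero_mul, ← Finset.sum_mul, rowProd]
  ring

/-- The left side is the total over columns extended by a diagonal box, holding `β` or `α`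
respectively. By the bottom-box recursion, each further row in `A` multiplies this combination by `x
+ b`, although neither summand factors alone. -/
theorem columnSum_one {m : ℕ} (a b x : R) (A : Fin m → Prop) :
    b * columnSum a b x A (fun _ => 1) + a * x * rowProd A x =
      (b + a * x) * rowProd A (x + b) := by
  classical
  induction m with
  | zero => simp [columnSum, rowProd, ColumnValid]
  | succ m ih =>
    have := ih fun i => A i.castSucc
    rw [rowProd_succ, rowProd_succ A]
    by_cases h : A (Fin.last m)
    · rw [columnSum_succ_of_pos a b x _ h, if_pos h, if_pos h]
      linear_combination (x + b) * this
    · rw [columnSum_succ_of_not a b x _ h, if_neg h, if_neg h]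
      linear_combination this

/-! ### Splitting off the first column of a tableau -/

/-- Row `i` of `S` contains no `β`. -/
def BetaFree {n : ℕ} (S : ABTableau n) (i : Fin n) : Prop :=
  ∀ j, S.entry i j ≠ some .beta

/-- The weight of `S`, with an additional factor `z` for each non-empty box on the second main
diagonal. -/
noncomputable def markedWeight {n : ℕ} (a b z : R) (S : ABTableau n) : R :=
  a ^ S.count .alpha * b ^ S.count .beta * z ^ S.secondDiagonalCount

theorem markedWeight_eq_prod {n : ℕ} (a b z : R) (S : ABTableau n) :
    markedWeight a b z S = ∏ i : Fin n, ∏ j : Fin n, symbolWeight a b (S.entry i j) *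
      (if (i : ℕ) + j + 2 = n ∧ S.entry i j ≠ none then z else 1) := by
  have key : ∀ y : R, ∀ p : Fin n × Fin n → Prop, ∀ _ : DecidablePred p,
      y ^ (Finset.univ.filter p).card = ∏ i : Fin n, ∏ j : Fin n, if p (i, j) then y else 1 := by
    intro y p _
    rw [← Finset.prod_const, Finset.prod_filter, Fintype.prod_prod_type]
  rw [markedWeight, count, count, secondDiagonalCount, key, key, key,
    ← Finset.prod_mul_distrib, ← Finset.prod_mul_distrib]
  refine Finset.prod_congr rfl fun i _ => ?_
  rw [← Finset.prod_mul_distrib, ← Finset.prod_mul_distrib]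
  refine Finset.prod_congr rfl fun j _ => ?_
  congr 1
  rcases h : S.entry i j with _ | _ | _ <;> simp [symbolWeight]

/-- The tableau obtained by deleting the first column. -/
def core {n : ℕ} (S : ABTableau (n + 1)) : ABTableau n where
  entry i j := S.entry i.castSucc j.succ
  outside i j h := S.outside _ _ (by simp; omega)
  above_alpha i j h i' hi := S.above_alpha _ _ h _ (by simpa using hi)
  left_beta i j h j' hj := S.left_beta _ _ h _ (by simpa using hj)
  diagonal i j h := S.diagonal _ _ (by simp [← h]; omega)

/-- The column `c` above the symbol `d` may be attached to the left of `S`. -/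
def Attachable {n : ℕ} (S : ABTableau n) (c : Fin n → Option BoxSymbol) :
    Option BoxSymbol → Prop
  | none => False
  | some .alpha => c = fun _ => none
  | some .beta => ColumnValid S.BetaFree c

theorem entry_last_succ {n : ℕ} (S : ABTableau (n + 1)) (j : Fin n) :
    S.entry (Fin.last n) j.succ = none :=
  S.outside _ _ (by simp)

theorem entry_last_zero {n : ℕ} (S : ABTableau (n + 1)) : S.entry (Fin.last n) 0 ≠ none :=
  S.diagonal _ _ (by simp)

theorem columnValid_column {n : ℕ} (S : ABTableau (n + 1)) :
    ColumnValid S.core.BetaFree (fun i => S.entry i.castSucc 0) := by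
  refine ⟨fun i hi j hj => hi (S.left_beta _ _ hj _ (by simp)),
    fun i hi i' h => S.above_alpha _ _ hi _ (by simpa using h)⟩

theorem attachable_column {n : ℕ} (S : ABTableau (n + 1)) :
    Attachable S.core (fun i => S.entry i.castSucc 0) (S.entry (Fin.last n) 0) := by
  rcases h : S.entry (Fin.last n) 0 with _ | _ | _
  · exact S.entry_last_zero h
  · exact funext fun i => S.above_alpha _ _ h _ (Fin.castSucc_lt_last i)
  · exact S.columnValid_column

/-- The tableau obtained by attaching a column to the left. -/
def attach {n : ℕ} (S : ABTableau n) (c : Fin n → Option BoxSymbol) (d : Option BoxSymbol)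
    (h : Attachable S c d) : ABTableau (n + 1) where
  entry := Fin.snoc (fun i => Fin.cons (c i) (S.entry i)) (Fin.cons d fun _ => none)
  outside i j hij := by
    induction i using Fin.lastCases with
    | last =>
      cases j using Fin.cases with
      | zero => simp at hij
      | succ j => simp
    | cast i =>
      cases j using Fin.cases with
      | zero => simp at hij; omega
      | succ j => simpa using S.outside i j (by simp at hij; omega)
  above_alpha i j hij i' hi := by
    have hi'' : i' ≠ Fin.last n := (hi.trans_le (Fin.le_last i)).ne
    obtain ⟨i', rfl⟩ := Fin.exists_castSucc_eq.2 hi''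
    induction i using Fin.lastCases with
    | last =>
      cases j using Fin.cases with
      | zero =>
        simp at hij
        subst hij
        simp [show c = fun _ => none from h]
      | succ j => simp at hij
    | cast i =>
      cases j using Fin.cases with
      | zero =>
        simp at hij ⊢
        rcases d with _ | _ | _
        · exact h.elim
        · simp [show c = fun _ => none from h] at hij
        · exact (show ColumnValid _ c from h).2 i hij i' (by simpa using hi)
      | succ j => simpa using S.above_alpha i j (by simpa using hij) i' (by simpa using hi)
  left_beta i j hij j' hj := by
    obtain ⟨j, rfl⟩ := Fin.exists_succ_eq.2 (Fin.ne_zero_of_lt hj)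
    induction i using Fin.lastCases with
    | last => simp at hij
    | cast i =>
      cases j' using Fin.cases with
      | zero =>
        simp at hij ⊢
        rcases d with _ | _ | _
        · exact h.elim
        · simp [show c = fun _ => none from h]
        · by_contra hc
          exact (show ColumnValid _ c from h).1 i hc j hij
      | succ j' => simpa using S.left_beta i j (by simpa using hij) j' (by simpa using hj)
  diagonal i j hij := by
    induction i using Fin.lastCases with
    | last =>
      cases j using Fin.cases with
      | zero =>
        rintro h0
        simp at h0
        subst h0
        exact h
      | succ j => simp at hij
    | cast i =>
      cases j using Fin.cases with
      | zero => simp at hij; omega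
      | succ j => simpa using S.diagonal i j (by simp at hij; omega)

open Classical in
/-- Summation over tableaux by splitting off the first column. -/
theorem sum_eq_sum_attachable {n : ℕ} (f : ABTableau (n + 1) → R)
    (g : ABTableau n → (Fin n → Option BoxSymbol) → Option BoxSymbol → R)
    (hfg : ∀ S, f S = g S.core (fun i => S.entry i.castSucc 0) (S.entry (Fin.last n) 0)) :
    ∑ S, f S = ∑ S, (g S (fun _ => none) (some .alpha) +
      ∑ c, if ColumnValid S.BetaFree c then g S c (some .beta) else 0) := by
  have h1 : ∑ S, f S = ∑ p ∈ (Finset.univ.filter fun p :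
      ABTableau n × Option BoxSymbol × (Fin n → Option BoxSymbol) =>
        Attachable p.1 p.2.2 p.2.1), g p.1 p.2.2 p.2.1 := by
    refine Finset.sum_nbij
      (fun S => (S.core, S.entry (Fin.last n) 0, fun i => S.entry i.castSucc 0)) ?_ ?_ ?_ ?_
    · intro S _
      simpa using S.attachable_column
    · intro S _ T _ hST
      simp only [Prod.mk.injEq] at hST
      obtain ⟨h1, h2, h3⟩ := hST
      ext i j : 3
      induction i using Fin.lastCases with
      | last =>
        cases j using Fin.cases with
        | zero => exact h2
        | succ j => rw [entry_last_succ, entry_last_succ]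
      | cast i =>
        cases j using Fin.cases with
        | zero => exact congrFun h3 i
        | succ j => exact congrFun (congrFun (congrArg entry h1) i) j
    · rintro ⟨S, d, c⟩ h
      have h : Attachable S c d := by simpa using h
      refine ⟨attach S c d h, by simp, ?_⟩
      simp [attach, core]
    · exact fun S _ => hfg S
  rw [h1, Finset.sum_filter, Fintype.sum_prod_type]
  refine Finset.sum_congr rfl fun S _ => ?_
  rw [Fintype.sum_prod_type, sum_option_boxSymbol]
  rw [← zero_add (g S _ _ + _)]
  refine congrArg₂ _ (Finset.sum_eq_zero fun c _ => if_neg id) (congrArg₂ _ ?_ rfl)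
  exact (Fintype.sum_eq_single (fun _ => none : Fin n → Option BoxSymbol)
    fun c hc => if_neg hc).trans (if_pos rfl)

theorem betaFree_last {n : ℕ} (S : ABTableau (n + 1)) :
    S.BetaFree (Fin.last n) ↔ S.entry (Fin.last n) 0 ≠ some .beta := by
  simp [BetaFree, Fin.forall_fin_succ, entry_last_succ]

theorem betaFree_castSucc {n : ℕ} (S : ABTableau (n + 1)) (i : Fin n) :
    S.BetaFree i.castSucc ↔ S.entry i.castSucc 0 ≠ some .beta ∧ S.core.BetaFree i := by
  simp [BetaFree, Fin.forall_fin_succ, core]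

theorem markedWeight_succ {n : ℕ} (a b z : R) (S : ABTableau (n + 1)) :
    markedWeight a b z S = markedWeight a b z S.core * symbolWeight a b (S.entry (Fin.last n) 0) *
      ∏ i : Fin n, symbolWeight a b (S.entry i.castSucc 0) *
        (if (i : ℕ) + 1 = n ∧ S.entry i.castSucc 0 ≠ none then z else 1) := by
  rw [markedWeight_eq_prod, markedWeight_eq_prod, Fin.prod_univ_castSucc]
  simp only [Fin.prod_univ_succ, Finset.prod_mul_distrib]
  have h : ∀ i j : Fin n, (i : ℕ) + (j + 1) + 2 = n + 1 ↔ (i : ℕ) + j + 2 = n := by omega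
  simp [entry_last_succ, symbolWeight, core, h]
  ring_nf

open Classical in
theorem markedWeight_mul_rowProd {n : ℕ} (a b z x : R) (S : ABTableau (n + 1)) :
    markedWeight a b z S * rowProd S.BetaFree x =
      markedWeight a b z S.core * columnWeight a b x True 1 (S.entry (Fin.last n) 0) *
      ∏ i : Fin n, columnWeight a b x (S.core.BetaFree i) (if (i : ℕ) + 1 = n then z else 1)
        (S.entry i.castSucc 0) := by
  have hlast : symbolWeight a b (S.entry (Fin.last n) 0) *
      (if S.BetaFree (Fin.last n) then x else 1) =
        columnWeight a b x True 1 (S.entry (Fin.last n) 0) := by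
    rw [betaFree_last]
    rcases h : S.entry (Fin.last n) 0 with _ | _ | _ <;> simp [symbolWeight, columnWeight]
  rw [markedWeight_succ, rowProd_succ, ← hlast]
  have hprod : (∏ i : Fin n, symbolWeight a b (S.entry i.castSucc 0) *
        (if (i : ℕ) + 1 = n ∧ S.entry i.castSucc 0 ≠ none then z else 1)) *
      rowProd (fun i : Fin n => S.BetaFree i.castSucc) x =
      ∏ i : Fin n, columnWeight a b x (S.core.BetaFree i) (if (i : ℕ) + 1 = n then z else 1)
        (S.entry i.castSucc 0) := by
    rw [rowProd, ← Finset.prod_mul_distrib]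
    refine Finset.prod_congr rfl fun i _ => ?_
    have hv := S.columnValid_column.1 i
    rw [betaFree_castSucc]
    rcases h : S.entry i.castSucc 0 with _ | _ | _
    · simp [symbolWeight, columnWeight]
    -- An `α` needs a core row without `β`, and that row stays free of `β`; hence the factor `x`.
    · have := hv (by simp [h])
      simp [symbolWeight, columnWeight, this]
      ring_nf
    · simp [symbolWeight, columnWeight]
      ring_nf
  rw [← hprod]
  ring

/-! ### The recursion for the generating function and its solution -/

/-- The generating function of tableaux of size `n`: `a` and `b` mark the symbols, `z` marks the
non-empty boxes of the second main diagonal and `x` marks the rows without `β`. -/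
noncomputable def genFun (n : ℕ) (a b z x : R) : R :=
  ∑ S : ABTableau n, markedWeight a b z S * rowProd S.BetaFree x

theorem genFun_succ_eq_sum (n : ℕ) (a b z x : R) :
    genFun (n + 1) a b z x = ∑ S : ABTableau n, markedWeight a b z S *
      (a * x * rowProd S.BetaFree x +
        b * columnSum a b x S.BetaFree (fun i => if (i : ℕ) + 1 = n then z else 1)) := by
  classical
  rw [genFun, sum_eq_sum_attachable _ (fun S c d => markedWeight a b z S *
    columnWeight a b x True 1 d *
      ∏ i : Fin n, columnWeight a b x (S.BetaFree i) (if (i : ℕ) + 1 = n then z else 1) (c i))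
    fun S => markedWeight_mul_rowProd a b z x S]
  refine Finset.sum_congr rfl fun S _ => ?_
  rw [mul_add, columnSum, Finset.mul_sum, Finset.mul_sum]
  congr 1
  · simp [columnWeight, rowProd]
    ring
  · refine Finset.sum_congr rfl fun c _ => ?_
    split_ifs
    · simp [columnWeight]
      ring
    · simp

-- If the bottom row has no `β`, its only box holds `α`, so the rest of the first column is empty
-- and the remaining tableau of size `n` is arbitrary.
open Classical in
theorem sum_betaFree_last (n : ℕ) (a b z x : R) :
    (∑ S : ABTableau (n + 1), if S.BetaFree (Fin.last n) then
      markedWeight a b z S * rowProd (fun i : Fin n => S.BetaFree i.castSucc) x else 0) =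
    a * genFun n a b z x := by
  rw [sum_eq_sum_attachable _ (fun S c d => if d = some .beta then 0 else
    markedWeight a b z S * symbolWeight a b d * (∏ i : Fin n, symbolWeight a b (c i) *
        (if (i : ℕ) + 1 = n ∧ c i ≠ none then z else 1)) *
      rowProd (fun i => c i ≠ some .beta ∧ S.BetaFree i) x)]
  · simp [genFun, symbolWeight, Finset.mul_sum]
    refine Finset.sum_congr rfl fun S _ => ?_
    change _ * rowProd S.BetaFree x = _
    ring
  · intro S
    simp only [betaFree_last, betaFree_castSucc, markedWeight_succ, ite_not]

theorem genFun_zero (a b z x : R) : genFun 0 a b z x = 1 := by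
  have : Unique (ABTableau 0) :=
    { default := ⟨fun i => i.elim0, fun i => i.elim0, fun i => i.elim0, fun i => i.elim0,
        fun i => i.elim0⟩
      uniq := fun S => by ext i; exact i.elim0 }
  simp [genFun, markedWeight_eq_prod, rowProd]

theorem genFun_one (a b z x : R) : genFun 1 a b z x = a * x + b := by
  have := genFun_zero a b z x
  rw [genFun] at this
  rw [genFun_succ_eq_sum]
  simp only [rowProd, Finset.univ_eq_empty, Finset.prod_empty, mul_one] at this ⊢
  simp [columnSum, ColumnValid, ← Finset.sum_mul, this]

/-- The marked box of the new column lies in the bottom row of the old tableau. If that row has no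
`β`, its factor is `x + z * b` instead of `x + b`; the excess `b * (z - 1)` is summed by
`sum_betaFree_last`. Otherwise the box is empty and no correction arises. -/
theorem genFun_add_two (n : ℕ) (a b z x : R) :
    genFun (n + 2) a b z x = (a * x + b) *
      (genFun (n + 1) a b z (x + b) + a * b * (z - 1) * genFun n a b z (x + b)) := by
  classical
  have h := sum_betaFree_last n a b z (x + b)
  rw [genFun_succ_eq_sum, show a * b * (z - 1) * genFun n a b z (x + b) =
    b * (z - 1) * (a * genFun n a b z (x + b)) by ring, ← h, genFun, Finset.mul_sum,
    ← Finset.sum_add_distrib, Finset.mul_sum]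
  refine Finset.sum_congr rfl fun S _ => ?_
  have hζ : (fun i : Fin n => if ((i.castSucc : Fin (n + 1)) : ℕ) + 1 = n + 1 then z else 1) =
      fun _ => 1 := by
    funext i
    rw [if_neg (by simp; omega)]
  have h1 := columnSum_one a b x (fun i : Fin n => S.BetaFree i.castSucc)
  rw [rowProd_succ, rowProd_succ S.BetaFree]
  by_cases hS : S.BetaFree (Fin.last n)
  · rw [columnSum_succ_of_pos a b x _ hS, hζ, if_pos hS, if_pos hS, if_pos hS]
    simp only [Fin.val_last, if_true]
    linear_combination markedWeight a b z S * (x + z * b) * h1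
  · rw [columnSum_succ_of_not a b x _ hS, hζ, if_neg hS, if_neg hS, if_neg hS]
    linear_combination markedWeight a b z S * h1

/-- Pascal's rule, in the shape of the two-step recursion. -/
theorem sum_antidiagonal_choose_mul (n : ℕ) (w : R) (f : ℕ → R) :
    ∑ p ∈ Finset.HasAntidiagonal.antidiagonal (n + 2), (p.1.choose p.2 : R) * w ^ p.2 * f p.1 =
      ∑ p ∈ Finset.HasAntidiagonal.antidiagonal (n + 1),
        (p.1.choose p.2 : R) * w ^ p.2 * f (p.1 + 1) +
      w * ∑ p ∈ Finset.HasAntidiagonal.antidiagonal n,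
        (p.1.choose p.2 : R) * w ^ p.2 * f (p.1 + 1) := by
  rw [Finset.Nat.sum_antidiagonal_succ, Finset.Nat.sum_antidiagonal_succ',
    Finset.Nat.sum_antidiagonal_succ' (n := n)]
  simp only [Nat.choose_succ_succ, Nat.choose_zero_right, Nat.cast_add, add_mul,
    Finset.sum_add_distrib, Finset.mul_sum]
  have : ∑ p ∈ Finset.HasAntidiagonal.antidiagonal n,
      (p.1.choose p.2 : R) * w ^ (p.2 + 1) * f (p.1 + 1) =
      ∑ p ∈ Finset.HasAntidiagonal.antidiagonal n,
        w * ((p.1.choose p.2 : R) * w ^ p.2 * f (p.1 + 1)) :=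
    Finset.sum_congr rfl fun p _ => by ring
  rw [this]
  simp
  ring

theorem genFun_eq_sum (n : ℕ) (a b z x : R) :
    genFun n a b z x = ∑ p ∈ Finset.HasAntidiagonal.antidiagonal n,
      (p.1.choose p.2 : R) * (a * b * (z - 1)) ^ p.2 *
        ∏ i ∈ Finset.range p.1, (a * x + b + i * (a * b)) := by
  induction n using Nat.twoStepInduction generalizing x with
  | zero => simp [genFun_zero]
  | one => simp [genFun_one, Finset.Nat.antidiagonal_succ]
  | more n ih0 ih1 =>
    -- The shift `x ↦ x + b` adds `a * b` to each factor, which raises its index by one.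
    have hprod : ∀ k : ℕ, ∏ i ∈ Finset.range (k + 1), (a * x + b + i * (a * b)) =
        (a * x + b) * ∏ i ∈ Finset.range k, (a * (x + b) + b + i * (a * b)) := by
      intro k
      rw [Finset.prod_range_succ', mul_comm]
      congr 1
      · simp
      · exact Finset.prod_congr rfl fun i _ => by push_cast; ring
    rw [genFun_add_two, ih0, ih1, sum_antidiagonal_choose_mul n (a * b * (z - 1))
      fun k => ∏ i ∈ Finset.range k, (a * x + b + i * (a * b))]
    simp only [hprod, mul_add, Finset.mul_sum]
    congr 1 <;> exact Finset.sum_congr rfl fun p _ => by ring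

end GeneratingFunction

end ABTableau

namespace ABTableau

/-! ### Asymptotics of the binomial moments -/

section FactorialMoments

open scoped Nat

/-- The `r`-th binomial moment of the second diagonal count for tableaux of size `k + r`, when the
inverse weights have the sum `s`. -/
noncomputable def binomialMoment (k r : ℕ) (s : ℝ) : ℝ :=
  k.choose r / ∏ j ∈ Finset.range r, (s + k + j)

theorem binomialMoment_zero_right (k : ℕ) (s : ℝ) : binomialMoment k 0 s = 1 := by
  simp [binomialMoment]

theorem binomialMoment_of_lt {k r : ℕ} (h : k < r) (s : ℝ) : binomialMoment k r s = 0 := by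
  simp [binomialMoment, Nat.choose_eq_zero_of_lt h]

theorem binomialMoment_nonneg (k r : ℕ) {s : ℝ} (hs : 0 ≤ s) : 0 ≤ binomialMoment k r s :=
  div_nonneg (by positivity) (Finset.prod_nonneg fun j _ => by positivity)

theorem binomialMoment_le (k r : ℕ) {s : ℝ} (hs : 0 ≤ s) :
    binomialMoment k r s ≤ 1 / (r ! : ℝ) := by
  -- For `k = s = 0` and `r > 0` the denominator vanishes, so the value `0` must come from the
  -- binomial coefficient.
  rcases Nat.eq_zero_or_pos k with rfl | hk
  · cases r with
    | zero => simp [binomialMoment]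
    | succ r =>
      rw [binomialMoment_of_lt (by omega)]
      positivity
  have hk' : (0 : ℝ) < k := by exact_mod_cast hk
  have h1 : (k : ℝ) ^ r ≤ ∏ j ∈ Finset.range r, (s + k + j) := by
    calc (k : ℝ) ^ r = ∏ j ∈ Finset.range r, (k : ℝ) := by simp
      _ ≤ _ := Finset.prod_le_prod (fun _ _ => hk'.le) fun j _ => by
        have : (0 : ℝ) ≤ j := by positivity
        linarith
  have h2 : (k.choose r : ℝ) ≤ (k : ℝ) ^ r / r ! := Nat.choose_le_pow_div r k
  rw [binomialMoment, div_le_div_iff₀ (lt_of_lt_of_le (by positivity) h1) (by positivity)]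
  rw [le_div_iff₀ (by positivity)] at h2
  linarith

/-- Continuity reaches `s = 0`, the case of two infinite weights: a moment with `1 ≤ r ≤ k` has a
positive denominator there. -/
theorem tendsto_binomialMoment_nhds (k r : ℕ) {s : ℝ} (hs : 0 ≤ s) :
    Tendsto (binomialMoment k r) (𝓝 s) (𝓝 (binomialMoment k r s)) := by
  rcases lt_or_ge k r with h | h
  · simp only [funext (binomialMoment_of_lt h), tendsto_const_nhds]
  rcases Nat.eq_zero_or_pos r with rfl | hr
  · simp only [funext (binomialMoment_zero_right k), tendsto_const_nhds]
  have hk : (0 : ℝ) < k := by exact_mod_cast (by omega)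
  have hc : Continuous fun s : ℝ => ∏ j ∈ Finset.range r, (s + k + j) := by fun_prop
  exact tendsto_const_nhds.div (hc.tendsto s)
    (Finset.prod_pos fun j _ => by positivity).ne'

theorem tendsto_binomialMoment_atTop (r : ℕ) (s : ℝ) :
    Tendsto (fun k => binomialMoment k r s) atTop (𝓝 (1 / (r ! : ℝ))) := by
  have h1 : Tendsto (fun k : ℕ => (k.choose r : ℝ) * (1 / (k : ℝ)) ^ r) atTop
      (𝓝 (1 ^ r / (r ! : ℝ))) := by
    refine tendsto_choose_mul_pow_atTop r (tendsto_const_nhds.congr' ?_)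
    filter_upwards [eventually_gt_atTop 0] with k hk
    field_simp
  have h2 : ∀ j ∈ Finset.range r,
      Tendsto (fun k : ℕ => (s + k + j) * (1 / (k : ℝ))) atTop (𝓝 1) := by
    intro j _
    have h3 : Tendsto (fun k : ℕ => (s + j) * (1 / (k : ℝ)) + 1) atTop (𝓝 ((s + j) * 0 + 1)) :=
      (tendsto_one_div_atTop_nhds_zero_nat.const_mul _).add_const _
    rw [mul_zero, zero_add] at h3
    refine h3.congr' ?_
    filter_upwards [eventually_gt_atTop 0] with k hk
    field_simp
    ring
  have h4 := h1.div (tendsto_finsetProd _ h2) (by simp)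
  simp only [Finset.prod_const_one, one_pow, div_one] at h4
  refine h4.congr' ?_
  filter_upwards [eventually_gt_atTop 0] with k hk
  have hk : (k : ℝ) ≠ 0 := by positivity
  rw [Pi.div_apply, Finset.prod_mul_distrib, Finset.prod_const, Finset.card_range, binomialMoment]
  exact mul_div_mul_right _ _ (by positivity)

theorem tendsto_sum_binomialMoment {s : ℝ} (hs : 0 ≤ s) (w : ℂ) :
    Tendsto (fun n => ∑ p ∈ Finset.HasAntidiagonal.antidiagonal n,
      (binomialMoment p.1 p.2 s : ℂ) * w ^ p.2) atTop (𝓝 (Complex.exp w)) := by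
  have hexp : Complex.exp w = ∑' r : ℕ, ((1 / (r ! : ℝ) : ℝ) : ℂ) * w ^ r := by
    rw [Complex.exp_eq_exp_ℂ, NormedSpace.exp_eq_tsum_div]
    refine tsum_congr fun r => ?_
    push_cast
    ring
  have hsum : ∀ n, ∑ p ∈ Finset.HasAntidiagonal.antidiagonal n,
      (binomialMoment p.1 p.2 s : ℂ) * w ^ p.2 =
        ∑' r : ℕ, (binomialMoment (n - r) r s : ℂ) * w ^ r := by
    intro n
    rw [← Finset.Nat.sum_antidiagonal_swap,
      Finset.Nat.sum_antidiagonal_eq_sum_range_succ_mk, tsum_eq_sum]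
    · rfl
    · intro r hr
      -- For `r > n` truncated subtraction gives `n - r = 0 < r`, so the tail of the series
      -- vanishes.
      rw [binomialMoment_of_lt (by simp at hr; omega)]
      simp
  simp only [hsum, hexp]
  refine tendsto_tsum_of_dominated_convergence (bound := fun r => ‖w‖ ^ r / (r ! : ℝ))
    (Real.summable_pow_div_factorial ‖w‖) (fun r => ?_) (.of_forall fun n r => ?_)
  · refine Tendsto.mul_const _ ?_
    exact (Complex.continuous_ofReal.tendsto _).comp
      ((tendsto_binomialMoment_atTop r s).comp (tendsto_sub_atTop_nat r))
  · rw [norm_mul, norm_pow, Complex.norm_real, Real.norm_of_nonneg (binomialMoment_nonneg _ _ hs),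
      div_eq_mul_one_div, mul_comm]
    exact mul_le_mul_of_nonneg_left (binomialMoment_le _ _ hs) (by positivity)

end FactorialMoments

/-! ### The exact generating function for finite weights -/

section FiniteWeights

variable {n : ℕ}

theorem genFun_apply_one {R : Type*} [CommRing R] (n : ℕ) (a b z : R) :
    genFun n a b z 1 = ∑ S : ABTableau n, markedWeight a b z S := by
  simp [genFun, rowProd]

theorem sum_markedWeight (n : ℕ) {a b : ℂ} (ha : a ≠ 0) (hb : b ≠ 0) (z : ℂ) :
    ∑ S : ABTableau n, markedWeight a b z S =
      ∑ p ∈ Finset.HasAntidiagonal.antidiagonal n, (p.1.choose p.2 : ℂ) *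
        (a * b * (z - 1)) ^ p.2 * ∏ i ∈ Finset.range p.1, (a * b * (a⁻¹ + b⁻¹ + i)) := by
  rw [← genFun_apply_one, genFun_eq_sum]
  refine Finset.sum_congr rfl fun p _ => congrArg _ (Finset.prod_congr rfl fun i _ => ?_)
  field_simp
  ring

theorem sum_weight (n : ℕ) {a b : ℂ} (ha : a ≠ 0) (hb : b ≠ 0) :
    ∑ S : ABTableau n, markedWeight a b 1 S =
      ∏ i ∈ Finset.range n, (a * b * (a⁻¹ + b⁻¹ + i)) := by
  rw [sum_markedWeight n ha hb, Finset.sum_eq_single (n, 0)]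
  · simp
  · rintro ⟨k, r⟩ hp hne
    have hr : r ≠ 0 := by
      rintro rfl
      simp at hp
      exact hne (by rw [hp])
    simp [hr]
  · simp

theorem coe_weight (u v : ℝ≥0) (S : ABTableau n) :
    ((S.weight u v : ℝ) : ℂ) = markedWeight ((u : ℝ) : ℂ) ((v : ℝ) : ℂ) 1 S := by
  simp [weight, markedWeight]

theorem coe_partitionFunction (n : ℕ) {u v : ℝ≥0} (hu : 0 < u) (hv : 0 < v) :
    ((partitionFunction n u v : ℝ) : ℂ) = ∏ i ∈ Finset.range n,
      (((u : ℝ) : ℂ) * ((v : ℝ) : ℂ) * (((u : ℝ) : ℂ)⁻¹ + ((v : ℝ) : ℂ)⁻¹ + i)) := by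
  rw [← sum_weight n (by simpa using hu.ne') (by simpa using hv.ne'), partitionFunction]
  push_cast
  exact Finset.sum_congr rfl fun S _ => coe_weight u v S

theorem inv_add_inv_add_ne_zero {u v : ℝ≥0} (hu : 0 < u) (hv : 0 < v) (i : ℕ) :
    ((u : ℝ) : ℂ)⁻¹ + ((v : ℝ) : ℂ)⁻¹ + i ≠ 0 := by
  have hu' : (0 : ℝ) < u := hu
  have hv' : (0 : ℝ) < v := hv
  have : ((u : ℝ)⁻¹ + (v : ℝ)⁻¹ + i : ℝ) ≠ 0 := by positivity
  exact_mod_cast this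

theorem partitionFunction_ne_zero (n : ℕ) {u v : ℝ≥0} (hu : 0 < u) (hv : 0 < v) :
    partitionFunction n u v ≠ 0 := by
  intro h
  have := coe_partitionFunction n hu hv
  rw [h] at this
  refine Finset.prod_ne_zero_iff.2 (fun i _ => ?_) (this.symm.trans (by simp))
  exact mul_ne_zero (mul_ne_zero (by simpa using hu.ne') (by simpa using hv.ne'))
    (inv_add_inv_add_ne_zero hu hv i)

theorem sum_prob (n : ℕ) {u v : ℝ≥0} (hu : 0 < u) (hv : 0 < v) :
    ∑ S : ABTableau n, prob u v S = 1 := by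
  simp only [prob, ← Finset.sum_div]
  exact div_self (partitionFunction_ne_zero n hu hv)

/-- The probability generating function of the second diagonal count for finite weights. -/
theorem sum_prob_mul_pow (n : ℕ) {u v : ℝ≥0} (hu : 0 < u) (hv : 0 < v) (z : ℂ) :
    ∑ S : ABTableau n, ((prob u v S : ℝ) : ℂ) * z ^ S.secondDiagonalCount =
      ∑ p ∈ Finset.HasAntidiagonal.antidiagonal n,
        (binomialMoment p.1 p.2 ((u : ℝ)⁻¹ + (v : ℝ)⁻¹) : ℂ) * (z - 1) ^ p.2 := by
  have hu' : ((u : ℝ) : ℂ) ≠ 0 := by simpa using hu.ne'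
  have hv' : ((v : ℝ) : ℂ) ≠ 0 := by simpa using hv.ne'
  have h1 : ∀ S : ABTableau n, ((prob u v S : ℝ) : ℂ) * z ^ S.secondDiagonalCount =
      markedWeight ((u : ℝ) : ℂ) ((v : ℝ) : ℂ) z S / ((partitionFunction n u v : ℝ) : ℂ) := by
    intro S
    rw [prob, NNReal.coe_div, Complex.ofReal_div, coe_weight]
    simp only [markedWeight]
    ring
  simp only [h1]
  rw [← Finset.sum_div, sum_markedWeight n hu' hv', Finset.sum_div, coe_partitionFunction n hu hv]
  refine Finset.sum_congr rfl ?_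
  rintro ⟨k, r⟩ hp
  obtain rfl : k + r = n := by simpa using hp
  have hP : ∏ i ∈ Finset.range k, (((u : ℝ) : ℂ) * ((v : ℝ) : ℂ) *
      (((u : ℝ) : ℂ)⁻¹ + ((v : ℝ) : ℂ)⁻¹ + i)) ≠ 0 :=
    Finset.prod_ne_zero_iff.2 fun i _ =>
      mul_ne_zero (mul_ne_zero hu' hv') (inv_add_inv_add_ne_zero hu hv i)
  have hQ : ∏ j ∈ Finset.range r, (((u : ℝ) : ℂ)⁻¹ + ((v : ℝ) : ℂ)⁻¹ + k + j) ≠ 0 :=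
    Finset.prod_ne_zero_iff.2 fun j _ => by
      simpa [add_assoc] using inv_add_inv_add_ne_zero hu hv (k + j)
  have hR : ∏ j ∈ Finset.range r, (((u : ℝ) : ℂ) * ((v : ℝ) : ℂ) *
      (((u : ℝ) : ℂ)⁻¹ + ((v : ℝ) : ℂ)⁻¹ + ((k + j : ℕ) : ℂ))) =
      (((u : ℝ) : ℂ) * ((v : ℝ) : ℂ)) ^ r *
        ∏ j ∈ Finset.range r, (((u : ℝ) : ℂ)⁻¹ + ((v : ℝ) : ℂ)⁻¹ + k + j) := by
    rw [Finset.prod_mul_distrib, Finset.prod_const, Finset.card_range]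
    simp [add_assoc]
  have huv : (((u : ℝ) : ℂ) * ((v : ℝ) : ℂ)) ^ r ≠ 0 := pow_ne_zero _ (mul_ne_zero hu' hv')
  simp only [binomialMoment]
  -- The first `k` of the `k + r` factors of the partition function cancel, as does `(u * v) ^ r`.
  rw [Finset.prod_range_add, hR, mul_pow]
  push_cast
  generalize ∏ i ∈ Finset.range k, (((u : ℝ) : ℂ) * ((v : ℝ) : ℂ) *
      (((u : ℝ) : ℂ)⁻¹ + ((v : ℝ) : ℂ)⁻¹ + i)) = P at *
  generalize ∏ j ∈ Finset.range r, (((u : ℝ) : ℂ)⁻¹ + ((v : ℝ) : ℂ)⁻¹ + k + j) = Q at *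
  generalize (((u : ℝ) : ℂ) * ((v : ℝ) : ℂ)) ^ r = W at *
  field_simp

end FiniteWeights

/-! ### Existence of the laws and passage to infinite weights -/

section Laws

variable {n : ℕ}

theorem exists_isWeightedLaw {α β : ℝ≥0∞} (hα : 0 < α) (hβ : 0 < β) (n : ℕ) :
    ∃ P : ProbabilityMeasure (ABTableau n), IsWeightedLaw α β P := by
  have key : ∀ γ : ℝ≥0∞, 0 < γ → ∃ u : ℕ → ℝ≥0, (∀ k, 0 < u k) ∧
      (γ ≠ ∞ → ∀ k, (u k : ℝ≥0∞) = γ) ∧ Tendsto (fun k => (u k : ℝ≥0∞)) atTop (𝓝 γ) := by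
    intro γ hγ
    by_cases h : γ = ∞
    · subst h
      refine ⟨fun k => k + 1, fun k => by positivity, fun h => absurd rfl h, ?_⟩
      refine (ENNReal.tendsto_nat_nhds_top.comp (tendsto_add_atTop_nat 1)).congr fun k => ?_
      simp
    · refine ⟨fun _ => γ.toNNReal, fun _ => ENNReal.toNNReal_pos hγ.ne' h,
        fun _ _ => ENNReal.coe_toNNReal h, ?_⟩
      exact tendsto_const_nhds.congr fun _ => (ENNReal.coe_toNNReal h).symm
  obtain ⟨u, hu, hu', hut⟩ := key α hα
  obtain ⟨v, hv, hv', hvt⟩ := key β hβ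
  -- Probability vectors lie in a compact cube, so a subsequence converges; no convergence along the
  -- full sequence is needed.
  have hcompact : IsCompact (Set.pi Set.univ fun _ : ABTableau n => Set.Icc (0 : ℝ≥0) 1) :=
    isCompact_univ_pi fun _ => isCompact_Icc
  obtain ⟨p, -, φ, hφ, hp⟩ := hcompact.tendsto_subseq
    (x := fun k S => prob (u k) (v k) S) fun k S _ => ⟨zero_le, by
      rw [← sum_prob n (hu k) (hv k)]
      exact Finset.single_le_sum (f := fun S => prob (u k) (v k) S)
        (fun _ _ => zero_le) (Finset.mem_univ S)⟩
  have hp' := tendsto_pi_nhds.1 hp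
  have hsum : ∑ S, p S = 1 := by
    refine tendsto_nhds_unique (tendsto_finsetSum _ fun S _ => hp' S)
      (tendsto_const_nhds.congr fun k => ?_)
    exact (sum_prob n (hu _) (hv _)).symm
  let q : PMF (ABTableau n) := PMF.ofFintype (fun S => (p S : ℝ≥0∞)) (by exact_mod_cast hsum)
  refine ⟨⟨q.toMeasure, inferInstance⟩, u ∘ φ, v ∘ φ, fun k => hu _, fun k => hv _,
    fun h k => hu' h _, fun h k => hv' h _, hut.comp hφ.tendsto_atTop,
    hvt.comp hφ.tendsto_atTop, fun S => ?_⟩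
  let P : ProbabilityMeasure (ABTableau n) := ⟨q.toMeasure, inferInstance⟩
  have hPS : P {S} = p S := by
    rw [← ENNReal.coe_inj, ProbabilityMeasure.ennreal_coeFn_eq_coeFn_toMeasure]
    exact (PMF.toMeasure_apply_singleton q S (MeasurableSet.singleton S)).trans
      (PMF.ofFintype_apply _ _)
  change Tendsto _ _ (𝓝 (P {S}))
  rw [hPS]
  exact hp' S

theorem tendsto_coe_inv {u : ℕ → ℝ≥0} {γ : ℝ≥0∞} (hγ : 0 < γ)
    (hu : Tendsto (fun k => (u k : ℝ≥0∞)) atTop (𝓝 γ)) :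
    Tendsto (fun k => (u k : ℝ)⁻¹) atTop (𝓝 (γ⁻¹).toReal) := by
  have h := (ENNReal.tendsto_toReal (ENNReal.inv_ne_top.2 hγ.ne')).comp
    (tendsto_inv_iff.2 hu)
  exact h.congr fun k => by simp [ENNReal.toReal_inv]

/-- The probability generating function of the second diagonal count. -/
theorem IsWeightedLaw.sum_mul_pow {α β : ℝ≥0∞} (hα : 0 < α) (hβ : 0 < β)
    {P : ProbabilityMeasure (ABTableau n)} (hP : IsWeightedLaw α β P) (z : ℂ) :
    ∑ S : ABTableau n, ((P {S} : ℝ) : ℂ) * z ^ S.secondDiagonalCount =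
      ∑ p ∈ Finset.HasAntidiagonal.antidiagonal n,
        (binomialMoment p.1 p.2 ((α⁻¹).toReal + (β⁻¹).toReal) : ℂ) * (z - 1) ^ p.2 := by
  obtain ⟨u, v, hu, hv, -, -, hut, hvt, hS⟩ := hP
  have h1 : Tendsto (fun k => ∑ S : ABTableau n,
      ((prob (u k) (v k) S : ℝ) : ℂ) * z ^ S.secondDiagonalCount) atTop
      (𝓝 (∑ S : ABTableau n, ((P {S} : ℝ) : ℂ) * z ^ S.secondDiagonalCount)) :=
    tendsto_finsetSum _ fun S _ => Tendsto.mul_const _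
      ((Complex.continuous_ofReal.tendsto _).comp ((NNReal.tendsto_coe.2 (hS S))))
  refine tendsto_nhds_unique h1 ?_
  simp only [fun k => sum_prob_mul_pow n (hu k) (hv k) z]
  refine tendsto_finsetSum _ fun p _ => Tendsto.mul_const _ ?_
  exact (Complex.continuous_ofReal.tendsto _).comp
    ((tendsto_binomialMoment_nhds p.1 p.2 (by positivity)).comp
      ((tendsto_coe_inv hα hut).add (tendsto_coe_inv hβ hvt)))

theorem charFun_secondDiagonalCount (P : ProbabilityMeasure (ABTableau n)) (t : ℝ) :
    charFun ((P : Measure (ABTableau n)).map fun S => (S.secondDiagonalCount : ℝ)) t =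
      ∑ S : ABTableau n, ((P {S} : ℝ) : ℂ) *
        Complex.exp (t * Complex.I) ^ S.secondDiagonalCount := by
  rw [charFun_apply, integral_map (measurable_from_top.aemeasurable) (by fun_prop),
    integral_fintype (Integrable.of_finite)]
  refine Finset.sum_congr rfl fun S _ => ?_
  rw [Complex.real_smul, ← Complex.exp_nat_mul]
  congr 2
  simp
  ring

end Laws

end ABTableau

theorem theorem3p6 (α β : ℝ≥0∞) (hα : 0 < α) (hβ : 0 < β) :
    (∀ n : ℕ, ∃ P : ProbabilityMeasure (ABTableau n), ABTableau.IsWeightedLaw α β P) ∧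
    ∀ P : (n : ℕ) → ProbabilityMeasure (ABTableau n),
      (∀ n : ℕ, 1 ≤ n → ABTableau.IsWeightedLaw α β (P n)) →
      TendstoInDistribution
        (fun (n : ℕ) (S : ABTableau n) => (S.secondDiagonalCount : ℝ)) atTop
        (fun k : ℕ => (k : ℝ))
        (fun n => (P n : Measure (ABTableau n))) (poissonMeasure 1) := by
  refine ⟨ABTableau.exists_isWeightedLaw hα hβ, fun P hP => ?_⟩
  refine ⟨fun n => measurable_from_top.aemeasurable, by fun_prop, ?_⟩
  -- Lévy's continuity theorem; the generating function is then used at `z = exp (i t)`.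
  refine ProbabilityMeasure.tendsto_iff_tendsto_charFun.2 fun t => ?_
  have h := ABTableau.tendsto_sum_binomialMoment
    (s := (α⁻¹).toReal + (β⁻¹).toReal) (by positivity) (Complex.exp (t * Complex.I) - 1)
  rw [ProbabilityMeasure.coe_mk, charFun_map_cast_poissonMeasure]
  simp only [NNReal.coe_one, Complex.ofReal_one, one_mul]
  refine h.congr' ?_
  filter_upwards [eventually_ge_atTop 1] with n hn
  rw [ProbabilityMeasure.coe_mk, ABTableau.charFun_secondDiagonalCount,
    (hP n hn).sum_mul_pow hα hβ]
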